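/- Let $p\in(0,1)$, $s\in[0,1]$ and $\alpha=2p-1$. Let $(m_n)_{n\ge1}$ be integers with $1\le m_n\le n$ for all $n\ge 1$, $m_n\to\infty$, and $\gamma_n:=m_n/n\to\gamma$ for some $\gamma\in[0,1]$. On a probability space, let the following random variables be mutually independent: $X_1$, with $P(X_1=1)=s$ and $P(X_1=-1)=1-s$; $U_n$ uniform on $\{1,\dots,n\}$, for $n\ge1$; $U_{k,n}$ uniform on $\{1,\dots,m_n\}$, for $m_n<k\le n$; and signs $\varepsilon_n$ ($n\ge1$) and $\varepsilon_{k,n}$ ($m_n<k\le n$), each equal to $+1$ with probability $p$ and to $-1$ with probability $1-p$. Define the elephant random walk steps by $X_{n+1}=\varepsilon_nX_{U_n}$ for $n\ge1$, the triangular array by $$Y^{(n)}_k=\begin{cases}X_k,&1\le k\le m_n,\\ \varepsilon_{k,n}X_{U_{k,n}},&m_n<k\le n,\end{cases}$$ and set $T_n=\sum_{k=1}^nY^{(n)}_k$ (the elephant random walk with gradually increasing memory). Then $$\lim_{n\to\infty}\frac{T_n}{n}=0\quad\text{almost surely.}$$ Moreover, for every $c\in(\max\{\alpha,1/2\},1)$,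 $$\lim_{n\to\infty}\frac{\gamma_nT_n}{(m_n)^c}=0\quad\text{almost surely.}$$ -/

import Mathlib

open MeasureTheory ProbabilityTheory Filter Topology

/-- The sources of randomness of an elephant random walk with gradually increasing memory:
the first step, the recalled times `U_n` and the signs of the ordinary walk, and the recalled times
`U_{k,n}` and the signs of the triangular array (first argument: the row `n`; second: the
time `k`). A sign `+1` means that the recalled step is repeated, `-1` that it is reversed. -/
structure ERWNoise (Ω : Type*) where
  first : Ω → ℤ
  memory : ℕ → Ω → ℕ
  sign : ℕ → Ω → ℤ
  rowMemory : ℕ → ℕ → Ω → ℕ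
  rowSign : ℕ → ℕ → Ω → ℤ

/-- Labels of the random variables that are used: `n ≥ 1` for the ordinary walk, and
`m n < k ≤ n` for the row `n` of the triangular array. -/
inductive ERWLabel (m : ℕ → ℕ) : Type
  | first : ERWLabel m
  | memory (n : ℕ) (hn : 1 ≤ n) : ERWLabel m
  | sign (n : ℕ) (hn : 1 ≤ n) : ERWLabel m
  | rowMemory (n k : ℕ) (hmk : m n < k) (hkn : k ≤ n) : ERWLabel m
  | rowSign (n k : ℕ) (hmk : m n < k) (hkn : k ≤ n) : ERWLabel m

namespace ERWNoise

variable {Ω : Type*}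

/-- The random variable with a given label; the recalled times are read as integers. -/
def source (N : ERWNoise Ω) (m : ℕ → ℕ) : ERWLabel m → Ω → ℤ
  | .first => N.first
  | .memory n _ => fun ω => (N.memory n ω : ℤ)
  | .sign n _ => N.sign n
  | .rowMemory n k _ _ => fun ω => (N.rowMemory n k ω : ℤ)
  | .rowSign n k _ _ => N.rowSign n k

/-- The laws of the sources: the first step is `+1` with probability `s` and `-1` with probability
`1 - s`; `U_n` is uniform on `{1, …, n}` and `U_{k,n}` is uniform on `{1, …, m n}`; every sign is
`+1` with probability `p` and `-1` with probability `1 - p`; all of them are independent. -/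
structure HasERWLaw [MeasurableSpace Ω] (N : ERWNoise Ω) (P : Measure Ω) (s p : ℝ)
    (m : ℕ → ℕ) : Prop where
  measurable_source : ∀ i : ERWLabel m, Measurable (N.source m i)
  first_pos : P.real {ω | N.first ω = 1} = s
  first_neg : P.real {ω | N.first ω = -1} = 1 - s
  memory_unif : ∀ n : ℕ, 1 ≤ n → ∀ j ∈ Finset.Icc 1 n,
    P.real {ω | N.memory n ω = j} = 1 / (n : ℝ)
  sign_pos : ∀ n : ℕ, 1 ≤ n → P.real {ω | N.sign n ω = 1} = p
  sign_neg : ∀ n : ℕ, 1 ≤ n → P.real {ω | N.sign n ω = -1} = 1 - p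
  rowMemory_unif : ∀ n k : ℕ, m n < k → k ≤ n → ∀ j ∈ Finset.Icc 1 (m n),
    P.real {ω | N.rowMemory n k ω = j} = 1 / (m n : ℝ)
  rowSign_pos : ∀ n k : ℕ, m n < k → k ≤ n → P.real {ω | N.rowSign n k ω = 1} = p
  rowSign_neg : ∀ n k : ℕ, m n < k → k ≤ n → P.real {ω | N.rowSign n k ω = -1} = 1 - p
  indep : iIndepFun (N.source m) P

/-- The steps `X_1, X_2, …` of the ordinary elephant random walk: `X_1` is the first step and
`X_{n+1} = ± X_{U_n}` for `n ≥ 1`. There is no step `0`, and the value `0` is used where `U_n`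
is not in `{1, …, n}`, which has probability zero. -/
def step (N : ERWNoise Ω) (ω : Ω) : ℕ → ℤ
  | 0 => 0
  | 1 => N.first ω
  | n + 2 => if _h : N.memory (n + 1) ω < n + 2 then
      N.sign (n + 1) ω * N.step ω (N.memory (n + 1) ω) else 0
termination_by k => k

/-- The steps `Y^{(n)}_k` of the row `n` of the triangular array: `X_k` for `k ≤ m n`, and
`± X_{U_{k,n}}` for `m n < k ≤ n`. -/
def rowStep (N : ERWNoise Ω) (m : ℕ → ℕ) (n k : ℕ) (ω : Ω) : ℤ :=
  if k ≤ m n then N.step ω k else N.rowSign n k ω * N.step ω (N.rowMemory n k ω)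

/-- The partial sums `S^{(n)}_k` of the row `n`. -/
def rowSum (N : ERWNoise Ω) (m : ℕ → ℕ) (n k : ℕ) (ω : Ω) : ℤ :=
  ∑ i ∈ Finset.Icc 1 k, N.rowStep m n i ω

/-- The elephant random walk with gradually increasing memory, `T_n = S^{(n)}_n`. -/
def increasingMemoryWalk (N : ERWNoise Ω) (m : ℕ → ℕ) (n : ℕ) (ω : Ω) : ℤ :=
  N.rowSum m n n ω

end ERWNoise

/-! ### Exponential estimates -/

/-! Write `S_n` for the ordinary walk and `α = 2p - 1`. Given the past, the next step is a sign with
mean `α S_n / n`, so Hoeffding's lemma bounds the exponential moment of `S_{n+1}` at `θ` by `exp (θ²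
/ 2)` times that of `S_n` at `θ (1 + α / n)`. Hence `S_n` is subgaussian, up to a factor 2, with the
proxy `varianceProxy α n`, which is `O(n^{2b})` for every `b > max α (1/2)`. Chernoff's bound and
Borel–Cantelli then give `S_n / n^c → 0` almost surely for `c > max α (1/2)`.

In row `n`, the steps after time `m n` have conditional mean `α S_{m n} / m n` given the ordinary
walk. Their centred sum `D_n` (`rowDeviation`) has proxy `n - m n ≤ n`, so the same argument gives
`D_n / n^c → 0` for `c > 1/2`.

Finally `m n * T_n = (m n + (n - m n) α) S_{m n} + m n * D_n`, with a coefficient of absolute value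
at most `n`. Thus `γ_n |T_n| ≤ |S_{m n}| + γ_n |D_n|`, and `γ_n / (m n)^c ≤ n^{-c}` when `c ≤ 1`.
The choice `c = 1` gives the first claim, as `γ_n / m n = 1 / n`. -/

theorem cosh_add_mul_sinh_le_exp {x : ℝ} (hx : |x| ≤ 1) (θ : ℝ) :
    Real.cosh θ + x * Real.sinh θ ≤ Real.exp (θ * x + θ ^ 2 / 2) := by
  obtain ⟨h1, h2⟩ := abs_le.1 hx
  -- The law on `{1, -1}` with mean `x`: the left-hand side is its moment generating function, and
  -- Hoeffding's lemma on an interval of length 2 gives the proxy 1.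
  set μ : Measure ℝ := ENNReal.ofReal ((1 + x) / 2) • Measure.dirac 1 +
    ENNReal.ofReal ((1 - x) / 2) • Measure.dirac (-1) with hμ
  have hint : ∀ f : ℝ → ℝ, ∫ y, f y ∂μ = (1 + x) / 2 * f 1 + (1 - x) / 2 * f (-1) := by
    intro f
    rw [hμ, integral_add_measure, integral_smul_measure, integral_smul_measure, integral_dirac,
      integral_dirac, ENNReal.toReal_ofReal (by linarith), ENNReal.toReal_ofReal (by linarith)]
    · simp
    · exact (integrable_dirac (by simp)).smul_measure (by simp)
    · exact (integrable_dirac (by simp)).smul_measure (by simp)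
  have hprob : IsProbabilityMeasure μ := by
    constructor
    rw [hμ]
    simp only [Measure.coe_add, Measure.coe_smul, Pi.add_apply, Pi.smul_apply, measure_univ,
      smul_eq_mul, mul_one]
    rw [← ENNReal.ofReal_add (by linarith) (by linarith)]
    norm_num
    ring
  have hsupp : ∀ᵐ y ∂μ, id y ∈ Set.Icc (-1 : ℝ) 1 := by
    rw [hμ, ae_add_measure_iff]
    constructor
    · refine Measure.ae_smul_measure ?_ _
      refine (ae_dirac_iff (p := fun y : ℝ => id y ∈ Set.Icc (-1 : ℝ) 1) measurableSet_Icc).2 ?_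
      norm_num
    · refine Measure.ae_smul_measure ?_ _
      refine (ae_dirac_iff (p := fun y : ℝ => id y ∈ Set.Icc (-1 : ℝ) 1) measurableSet_Icc).2 ?_
      norm_num
  have hmgf := (hasSubgaussianMGF_of_mem_Icc aemeasurable_id hsupp).mgf_le θ
  have hmean : ∫ y, id y ∂μ = x := by rw [hint]; simp; ring
  rw [hmean, mgf, hint] at hmgf
  have hc : (((‖(1 : ℝ) - -1‖₊ / 2) ^ 2 : NNReal) : ℝ) = 1 := by norm_num
  rw [hc, one_mul] at hmgf
  have key : Real.cosh θ + x * Real.sinh θ = Real.exp (θ * x) *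
      ((1 + x) / 2 * Real.exp (θ * (id 1 - x)) + (1 - x) / 2 * Real.exp (θ * (id (-1) - x))) := by
    have e1 : Real.exp (θ * (id 1 - x)) = Real.exp θ * Real.exp (-(θ * x)) := by
      rw [← Real.exp_add]; congr 1; simp; ring
    have e2 : Real.exp (θ * (id (-1) - x)) = Real.exp (-θ) * Real.exp (-(θ * x)) := by
      rw [← Real.exp_add]; congr 1; simp; ring
    have e3 : Real.exp (θ * x) * Real.exp (-(θ * x)) = 1 := by rw [← Real.exp_add]; simp
    rw [e1, e2, Real.cosh_eq, Real.sinh_eq]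
    linear_combination (-((1 + x) / 2 * Real.exp θ + (1 - x) / 2 * Real.exp (-θ))) * e3
  rw [key, Real.exp_add]
  gcongr

theorem exp_mul_eq_cosh_add {x : ℝ} (hx : x = 1 ∨ x = -1) (θ : ℝ) :
    Real.exp (θ * x) = Real.cosh θ + x * Real.sinh θ := by
  rcases hx with rfl | rfl
  · rw [mul_one, one_mul, Real.cosh_add_sinh]
  · rw [mul_neg_one, neg_one_mul, ← sub_eq_add_neg, Real.cosh_sub_sinh]

/-- On signs, `exp (θ x)` is affine in `x`, so the average sees the `x j` only through their sum;
Hoeffding's bound then applies to the mean `(2p - 1) S / m`. -/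
theorem average_exp_signs_le {p : ℝ} (hp : p ∈ Set.Ioo (0 : ℝ) 1) {m : ℕ} (hm : 1 ≤ m)
    {x : ℕ → ℝ} (hx : ∀ j ∈ Finset.Icc 1 m, x j = 1 ∨ x j = -1) (θ : ℝ) :
    ∑ j ∈ Finset.Icc 1 m, (1 / (m : ℝ) * p * Real.exp (θ * x j) +
        1 / (m : ℝ) * (1 - p) * Real.exp (θ * -x j)) ≤
      Real.exp (θ ^ 2 / 2) * Real.exp (θ * ((2 * p - 1) * (∑ j ∈ Finset.Icc 1 m, x j) / m)) := by
  have hm0 : (0 : ℝ) < m := by exact_mod_cast hm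
  set S := ∑ j ∈ Finset.Icc 1 m, x j with hS
  have hSabs : |S| ≤ m := by
    refine (Finset.abs_sum_le_sum_abs _ _).trans ?_
    calc ∑ j ∈ Finset.Icc 1 m, |x j| ≤ ∑ j ∈ Finset.Icc 1 m, (1 : ℝ) :=
          Finset.sum_le_sum fun j hj => by rcases hx j hj with h | h <;> simp [h]
      _ = m := by simp
  have hbar : |(2 * p - 1) * S / m| ≤ 1 := by
    rw [abs_div, abs_mul, abs_of_pos hm0, div_le_one hm0]
    have : |2 * p - 1| ≤ 1 := abs_le.2 ⟨by linarith [hp.1], by linarith [hp.2]⟩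
    nlinarith [abs_nonneg S, abs_nonneg (2 * p - 1)]
  have hsum : ∑ j ∈ Finset.Icc 1 m, (1 / (m : ℝ) * p * Real.exp (θ * x j) +
        1 / (m : ℝ) * (1 - p) * Real.exp (θ * -x j)) =
      Real.cosh θ + (2 * p - 1) * S / m * Real.sinh θ := by
    have : ∀ j ∈ Finset.Icc 1 m, (1 / (m : ℝ) * p * Real.exp (θ * x j) +
        1 / (m : ℝ) * (1 - p) * Real.exp (θ * -x j)) =
        1 / (m : ℝ) * Real.cosh θ + x j * ((2 * p - 1) / m * Real.sinh θ) := by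
      intro j hj
      rw [exp_mul_eq_cosh_add (hx j hj), exp_mul_eq_cosh_add (x := -x j)
        (by rcases hx j hj with h | h <;> simp [h])]
      ring
    rw [Finset.sum_congr rfl this, Finset.sum_add_distrib,
      ← Finset.sum_mul (Finset.Icc 1 m) x, ← hS]
    simp only [Finset.sum_const, Nat.card_Icc, Nat.add_sub_cancel, nsmul_eq_mul]
    field_simp
  rw [hsum, ← Real.exp_add, add_comm (θ ^ 2 / 2)]
  exact cosh_add_mul_sinh_le_exp hbar θ

theorem summable_exp_neg_mul_natCast_rpow {a d : ℝ} (ha : 0 < a) (hd : 0 < d) :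
    Summable fun n : ℕ => Real.exp (-a * (n : ℝ) ^ d) := by
  -- The exponent `-2 / d`, evaluated at `n ^ d`, produces the summable `n ^ (-2)`.
  have h := (isLittleO_exp_neg_mul_rpow_atTop ha (-2 / d)).comp_tendsto
    ((tendsto_rpow_atTop hd).comp tendsto_natCast_atTop_atTop)
  refine summable_of_isBigO_nat (g := fun n : ℕ => (n : ℝ) ^ (-2 : ℝ))
    (Real.summable_nat_rpow.2 (by norm_num)) (h.isBigO.congr_right fun n => ?_)
  simp only [Function.comp]
  rw [← Real.rpow_mul (Nat.cast_nonneg n)]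
  congr 1
  field_simp

/-! ### The variance proxy of the elephant random walk -/

/-- The sequence with `v 1 = 1` and `v (n + 1) = (1 + α / n) ^ 2 * v n + 1`. -/
noncomputable def varianceProxy (α : ℝ) : ℕ → ℝ
  | 0 => 0
  | n + 1 => (1 + α / n) ^ 2 * varianceProxy α n + 1

theorem varianceProxy_nonneg (α : ℝ) (n : ℕ) : 0 ≤ varianceProxy α n := by
  induction n with
  | zero => exact le_rfl
  | succ n ih => rw [varianceProxy]; positivity

/-- By Bernoulli, `n ^ (2b)` grows by a factor at least `1 + 2b/n`. Once `n ≥ α² / (b - α)`, this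
exceeds `(1 + α/n)²` by at least `(b - α)/n`, and the surplus absorbs the `+ 1` because `n ^ (2b) ≥
n`. -/
theorem exists_varianceProxy_le {α b : ℝ} (hαb : α < b) (hb : 1 / 2 < b) :
    ∃ C : ℝ, 0 < C ∧ ∀ n : ℕ, 1 ≤ n → varianceProxy α n ≤ C * (n : ℝ) ^ (2 * b) := by
  obtain ⟨k, hk⟩ := exists_nat_ge (α ^ 2 / (b - α))
  have hd : 0 < b - α := sub_pos.2 hαb
  -- The first term makes `C * (b - α) ≥ 1`; the sum dominates the proxies before the growth
  -- comparison is available.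
  set C := 1 / (b - α) + ∑ i ∈ Finset.range (k + 2), varianceProxy α i with hC
  have hs : 0 ≤ ∑ i ∈ Finset.range (k + 2), varianceProxy α i :=
    Finset.sum_nonneg fun i _ => varianceProxy_nonneg α i
  have hC1 : 1 ≤ C * (b - α) := by
    rw [hC, add_mul, one_div, inv_mul_cancel₀ hd.ne']
    nlinarith
  have hC0 : 0 < C := by
    have : 0 < 1 / (b - α) := by positivity
    linarith
  refine ⟨C, hC0, fun n => ?_⟩
  induction n with
  | zero => intro h; omega
  | succ n ih =>
    intro _
    rcases Nat.lt_or_ge n (k + 1) with hn | hn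
    · have h1 : varianceProxy α (n + 1) ≤ C := by
        have := Finset.single_le_sum (f := varianceProxy α)
          (fun i _ => varianceProxy_nonneg α i) (Finset.mem_range.2 (by omega : n + 1 < k + 2))
        have : 0 < 1 / (b - α) := by positivity
        linarith
      have h2 : (1 : ℝ) ≤ ((n + 1 : ℕ) : ℝ) ^ (2 * b) :=
        Real.one_le_rpow (by push_cast; linarith [(Nat.cast_nonneg n : (0 : ℝ) ≤ n)])
          (by linarith)
      nlinarith
    · have hn1 : 1 ≤ n := by omega
      have hn0 : (0 : ℝ) < n := by exact_mod_cast hn1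
      have hn1' : (1 : ℝ) ≤ n := by exact_mod_cast hn1
      have ih := ih hn1
      have hkn : α ^ 2 ≤ (b - α) * n := by
        rw [div_le_iff₀ hd] at hk
        have : (k : ℝ) ≤ n := by exact_mod_cast (by omega : k ≤ n)
        nlinarith
      have hpow : ((n + 1 : ℕ) : ℝ) ^ (2 * b) = (n : ℝ) ^ (2 * b) * (1 + 1 / n) ^ (2 * b) := by
        rw [← Real.mul_rpow hn0.le (by positivity)]
        congr 1
        push_cast
        field_simp
      have hbern : 1 + 2 * b * (1 / n) ≤ (1 + 1 / (n : ℝ)) ^ (2 * b) :=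
        one_add_mul_self_le_rpow_one_add
          (by have : (0 : ℝ) ≤ 1 / n := by positivity
              linarith) (by linarith)
      have hnb : (n : ℝ) ≤ (n : ℝ) ^ (2 * b) := by
        simpa using Real.rpow_le_rpow_of_exponent_le hn1' (by linarith : (1 : ℝ) ≤ 2 * b)
      have hgap : 1 ≤ C * (n : ℝ) ^ (2 * b) * ((b - α) / n) := by
        have : C * (n : ℝ) ^ (2 * b) * ((b - α) / n) = C * (b - α) * ((n : ℝ) ^ (2 * b) / n) := by
          ring
        rw [this]
        have : 1 ≤ (n : ℝ) ^ (2 * b) / n := by rwa [le_div_iff₀ hn0, one_mul]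
        nlinarith
      have hsq : (1 + α / n) ^ 2 + (b - α) / n ≤ 1 + 2 * b * (1 / (n : ℝ)) := by
        have : (1 + α / n) ^ 2 + (b - α) / n = 1 + (α + b) / n + α ^ 2 / (n * n) := by
          field_simp; ring
        rw [this]
        have h3 : α ^ 2 / (n * n) ≤ (b - α) / n := by
          rw [div_le_div_iff₀ (by positivity) hn0]; nlinarith
        have h4 : (α + b) / n + (b - α) / n = 2 * b * (1 / (n : ℝ)) := by ring
        linarith
      rw [varianceProxy, hpow]
      have hCn : 0 < C * (n : ℝ) ^ (2 * b) := by positivity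
      calc (1 + α / n) ^ 2 * varianceProxy α n + 1
          ≤ (1 + α / n) ^ 2 * (C * (n : ℝ) ^ (2 * b)) + C * (n : ℝ) ^ (2 * b) * ((b - α) / n) := by
            gcongr
        _ = C * (n : ℝ) ^ (2 * b) * ((1 + α / n) ^ 2 + (b - α) / n) := by ring
        _ ≤ C * (n : ℝ) ^ (2 * b) * (1 + 1 / (n : ℝ)) ^ (2 * b) := by
            gcongr
            exact hsq.trans hbern
        _ = _ := by ring

/-! ### Almost sure convergence from bounds on exponential moments -/

section Probability

variable {Ω : Type*} {mΩ : MeasurableSpace Ω} {P : Measure Ω}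

theorem measure_ge_le_of_lintegral_exp_le {W : Ω → ℝ} (hW : Measurable W) {v t : ℝ} (hv : 0 < v)
    (ht : 0 ≤ t)
    (h : ∀ θ : ℝ, ∫⁻ ω, ENNReal.ofReal (Real.exp (θ * W ω)) ∂P ≤
      ENNReal.ofReal (2 * Real.exp (θ ^ 2 * v / 2))) :
    P {ω | t ≤ W ω} ≤ ENNReal.ofReal (2 * Real.exp (-(t ^ 2 / (2 * v)))) := by
  -- `θ = t / v` minimises `θ² v / 2 - θ t`.
  have hθ : 0 ≤ t / v := by positivity
  have hsub : {ω | t ≤ W ω} ⊆ {ω | ENNReal.ofReal (Real.exp (t / v * t)) ≤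
      ENNReal.ofReal (Real.exp (t / v * W ω))} := by
    intro ω hω
    exact ENNReal.ofReal_le_ofReal (Real.exp_le_exp.2 (mul_le_mul_of_nonneg_left hω hθ))
  have hmarkov := meas_ge_le_lintegral_div (μ := P)
    (f := fun ω => ENNReal.ofReal (Real.exp (t / v * W ω)))
    (by fun_prop) (ε := ENNReal.ofReal (Real.exp (t / v * t)))
    (by simp [Real.exp_pos]) ENNReal.ofReal_ne_top
  refine (measure_mono hsub).trans (hmarkov.trans ?_)
  refine (ENNReal.div_le_div_right (h (t / v)) _).trans ?_
  rw [← ENNReal.ofReal_div_of_pos (Real.exp_pos _), mul_div_assoc, ← Real.exp_sub]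
  refine ENNReal.ofReal_le_ofReal (le_of_eq ?_)
  congr 2
  field_simp
  ring

theorem measure_abs_ge_le_of_lintegral_exp_le {W : Ω → ℝ} (hW : Measurable W) {v t : ℝ}
    (hv : 0 < v) (ht : 0 ≤ t)
    (h : ∀ θ : ℝ, ∫⁻ ω, ENNReal.ofReal (Real.exp (θ * W ω)) ∂P ≤
      ENNReal.ofReal (2 * Real.exp (θ ^ 2 * v / 2))) :
    P {ω | t ≤ |W ω|} ≤ ENNReal.ofReal (4 * Real.exp (-(t ^ 2 / (2 * v)))) := by
  have h1 := measure_ge_le_of_lintegral_exp_le hW hv ht h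
  have h2 := measure_ge_le_of_lintegral_exp_le (P := P) hW.neg hv ht
    (fun θ => by simpa using h (-θ))
  have hsub : {ω | t ≤ |W ω|} ⊆ {ω | t ≤ W ω} ∪ {ω | t ≤ (-W) ω} := fun ω hω => by
    simpa [le_abs] using hω
  refine (measure_mono hsub).trans ((measure_union_le _ _).trans ((add_le_add h1 h2).trans ?_))
  rw [← ENNReal.ofReal_add (by positivity) (by positivity)]
  exact ENNReal.ofReal_le_ofReal (le_of_eq (by ring))

/-- At level `ε n^c` the tail is at most `4 exp (-ε² n^{2(c-b)} / (2C))`, which is summable.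
Borel–Cantelli needs no relation between the `W n`, and `ε = 1 / (k + 1)` leaves countably many null
sets. -/
theorem ae_tendsto_div_rpow_of_lintegral_exp_le {W : ℕ → Ω → ℝ} (hW : ∀ n, Measurable (W n))
    {b c C : ℝ} (hbc : b < c) (hC : 0 < C)
    (h : ∀ n : ℕ, 1 ≤ n → ∀ θ : ℝ, ∫⁻ ω, ENNReal.ofReal (Real.exp (θ * W n ω)) ∂P ≤
      ENNReal.ofReal (2 * Real.exp (θ ^ 2 * (C * (n : ℝ) ^ (2 * b)) / 2))) :
    ∀ᵐ ω ∂P, Tendsto (fun n : ℕ => W n ω / (n : ℝ) ^ c) atTop (𝓝 0) := by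
  have hev : ∀ k : ℕ, ∀ᵐ ω ∂P, ∀ᶠ n : ℕ in atTop, |W n ω| < 1 / ((k : ℝ) + 1) * (n : ℝ) ^ c := by
    intro k
    set ε : ℝ := 1 / ((k : ℝ) + 1) with hε
    have hε0 : 0 < ε := by positivity
    have hbound : ∀ n : ℕ, P {ω | ε * ((n + 1 : ℕ) : ℝ) ^ c ≤ |W (n + 1) ω|} ≤
        ENNReal.ofReal (4 * Real.exp (-(ε ^ 2 / (2 * C)) * ((n + 1 : ℕ) : ℝ) ^ (2 * (c - b)))) := by
      intro n
      have hn0 : (0 : ℝ) < ((n + 1 : ℕ) : ℝ) := by positivity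
      refine (measure_abs_ge_le_of_lintegral_exp_le (hW (n + 1)) (by positivity) (by positivity)
        (h (n + 1) (by omega))).trans (ENNReal.ofReal_le_ofReal (le_of_eq ?_))
      congr 2
      have : ((n + 1 : ℕ) : ℝ) ^ (2 * (c - b)) =
          (((n + 1 : ℕ) : ℝ) ^ c) ^ 2 / ((n + 1 : ℕ) : ℝ) ^ (2 * b) := by
        rw [← Real.rpow_natCast, ← Real.rpow_mul hn0.le, ← Real.rpow_sub hn0]
        congr 1
        push_cast
        ring
      rw [this]
      field_simp
    have hsum : ∑' n : ℕ, P {ω | ε * ((n + 1 : ℕ) : ℝ) ^ c ≤ |W (n + 1) ω|} ≠ ⊤ := by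
      refine ne_top_of_le_ne_top ?_ (ENNReal.tsum_le_tsum hbound)
      have := (summable_exp_neg_mul_natCast_rpow (a := ε ^ 2 / (2 * C)) (d := 2 * (c - b))
        (by positivity) (by linarith)).mul_left 4
      exact ((summable_nat_add_iff 1).2 this).tsum_ofReal_ne_top
    filter_upwards [ae_eventually_notMem hsum] with ω hω
    obtain ⟨n₀, hn₀⟩ := eventually_atTop.1 hω
    refine eventually_atTop.2 ⟨n₀ + 1, fun n hn => ?_⟩
    obtain ⟨j, rfl⟩ := Nat.exists_eq_add_of_le' (by omega : 1 ≤ n)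
    simpa using hn₀ j (by omega)
  filter_upwards [ae_all_iff.2 hev] with ω hω
  rw [Metric.tendsto_atTop]
  intro δ hδ
  obtain ⟨k, hk⟩ := exists_nat_one_div_lt hδ
  obtain ⟨n₀, hn₀⟩ := eventually_atTop.1 (hω k)
  refine ⟨max n₀ 1, fun n hn => ?_⟩
  have hn0 : (0 : ℝ) < n := by exact_mod_cast (le_max_right n₀ 1).trans hn
  have hnc : 0 < (n : ℝ) ^ c := Real.rpow_pos_of_pos hn0 c
  rw [Real.dist_eq, sub_zero, abs_div, abs_of_pos hnc, div_lt_iff₀ hnc]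
  exact (hn₀ n ((le_max_left _ _).trans hn)).trans (mul_lt_mul_of_pos_right hk hnc)

end Probability

/-! ### One step of a walk which recalls a uniformly chosen earlier step -/

section Recall

variable {Ω : Type*} {mΩ : MeasurableSpace Ω} {P : Measure Ω}

theorem ae_mem_of_sum_measureReal_eq_one {β : Type*} [IsProbabilityMeasure P] {U : Ω → β}
    {F : Finset β} (hU : ∀ j ∈ F, MeasurableSet {ω | U ω = j})
    (h : ∑ j ∈ F, P.real {ω | U ω = j} = 1) : ∀ᵐ ω ∂P, U ω ∈ F := by
  have hset : {ω | U ω ∈ F} = ⋃ j ∈ F, {ω | U ω = j} := by ext; simp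
  have hmeas : MeasurableSet {ω | U ω ∈ F} := by
    rw [hset]; exact F.measurableSet_biUnion hU
  have hreal : P.real {ω | U ω ∈ F} = 1 := by
    rw [hset, measureReal_biUnion_finset _ hU, h]
    intro i _ j _ hij
    refine Set.disjoint_left.2 fun ω hi hj => hij ?_
    exact (show U ω = i from hi).symm.trans hj
  have hone : P {ω | U ω ∈ F} = 1 := by
    rw [← ENNReal.toReal_eq_one_iff]; exact hreal
  exact (prob_compl_eq_zero_iff hmeas).2 hone

/-- A conditional Hoeffding bound without conditional expectations: `Z` carries the past, and the
integral is split over the finitely many events `{U = j, ε = e}`. Independence replaces their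
indicators by their probabilities, after which `average_exp_signs_le` applies pointwise. -/
theorem lintegral_mul_exp_recall_le {Ω : Type*} {F G mΩ : MeasurableSpace Ω} {P : Measure Ω}
    (hF : F ≤ mΩ) (hG : G ≤ mΩ)
    (hFG : Indep F G P) {m : ℕ} (hm : 1 ≤ m) {p : ℝ} (hp : p ∈ Set.Ioo (0 : ℝ) 1)
    {Z : Ω → ENNReal} (hZ : Measurable[F] Z) {X : ℕ → Ω → ℤ}
    (hX : ∀ j ∈ Finset.Icc 1 m, Measurable[F] (X j))
    (hX1 : ∀ j ∈ Finset.Icc 1 m, ∀ᵐ ω ∂P, X j ω = 1 ∨ X j ω = -1)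
    {U : Ω → ℕ} {ε : Ω → ℤ}
    (hA : ∀ j ∈ Finset.Icc 1 m, ∀ e : ℤ, MeasurableSet[G] {ω | U ω = j ∧ ε ω = e})
    (hU : ∀ᵐ ω ∂P, U ω ∈ Finset.Icc 1 m) (hε : ∀ᵐ ω ∂P, ε ω = 1 ∨ ε ω = -1)
    (hpos : ∀ j ∈ Finset.Icc 1 m, P {ω | U ω = j ∧ ε ω = 1} = ENNReal.ofReal (1 / m * p))
    (hneg : ∀ j ∈ Finset.Icc 1 m,
      P {ω | U ω = j ∧ ε ω = -1} = ENNReal.ofReal (1 / m * (1 - p))) (θ : ℝ) :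
    ∫⁻ ω, Z ω * ENNReal.ofReal (Real.exp (θ * ((ε ω * X (U ω) ω : ℤ) : ℝ))) ∂P ≤
      ENNReal.ofReal (Real.exp (θ ^ 2 / 2)) * ∫⁻ ω, Z ω * ENNReal.ofReal
        (Real.exp (θ * ((2 * p - 1) * ((∑ j ∈ Finset.Icc 1 m, X j ω : ℤ) : ℝ) / m))) ∂P := by
  set A : ℕ → ℤ → Set Ω := fun j e => {ω | U ω = j ∧ ε ω = e} with hAdef
  set g : ℕ → ℤ → Ω → ENNReal := fun j e ω =>
    Z ω * ENNReal.ofReal (Real.exp (θ * ((e * X j ω : ℤ) : ℝ))) with hgdef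
  have hg : ∀ j ∈ Finset.Icc 1 m, ∀ e, Measurable[F] (g j e) := by
    intro j hj e
    have hcomp : Measurable fun x : ℤ => ENNReal.ofReal (Real.exp (θ * ((e * x : ℤ) : ℝ))) :=
      measurable_from_top
    exact hZ.mul (hcomp.comp (hX j hj))
  have hone : ∀ j ∈ Finset.Icc 1 m, ∀ e,
      Measurable[G] ((A j e).indicator (1 : Ω → ENNReal)) := fun j hj e =>
    Measurable.indicator (f := (1 : Ω → ENNReal)) (by exact measurable_const) (hA j hj e)
  have hind : ∀ j ∈ Finset.Icc 1 m, ∀ e,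
      ∫⁻ ω, g j e ω * (A j e).indicator 1 ω ∂P = (∫⁻ ω, g j e ω ∂P) * P (A j e) := by
    intro j hj e
    rw [lintegral_mul_eq_lintegral_mul_lintegral_of_independent_measurableSpace hF hG hFG
      (hg j hj e) (hone j hj e),
      lintegral_indicator_one (hG _ (hA j hj e))]
  have hgm : ∀ j ∈ Finset.Icc 1 m, ∀ e, Measurable (g j e) := fun j hj e =>
    (hg j hj e).mono hF le_rfl
  have hgi : ∀ j ∈ Finset.Icc 1 m, ∀ e,
      Measurable fun ω => g j e ω * (A j e).indicator 1 ω := fun j hj e =>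
    (hgm j hj e).mul (measurable_one.indicator (hG _ (hA j hj e)))
  have hsplit : ∀ᵐ ω ∂P, Z ω * ENNReal.ofReal (Real.exp (θ * ((ε ω * X (U ω) ω : ℤ) : ℝ))) =
      ∑ j ∈ Finset.Icc 1 m, (g j 1 ω * (A j 1).indicator 1 ω +
        g j (-1) ω * (A j (-1)).indicator 1 ω) := by
    filter_upwards [hU, hε] with ω hUω hεω
    rw [Finset.sum_eq_single_of_mem (U ω) hUω]
    · rcases hεω with h | h <;> simp [hAdef, hgdef, h, Set.indicator]
    · intro j _ hj
      simp [hAdef, Set.indicator, hj.symm]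
  have hpw : ∀ᵐ ω ∂P, ∑ j ∈ Finset.Icc 1 m, (g j 1 ω * ENNReal.ofReal (1 / m * p) +
        g j (-1) ω * ENNReal.ofReal (1 / m * (1 - p))) ≤
      ENNReal.ofReal (Real.exp (θ ^ 2 / 2)) * (Z ω * ENNReal.ofReal
        (Real.exp (θ * ((2 * p - 1) * ((∑ j ∈ Finset.Icc 1 m, X j ω : ℤ) : ℝ) / m)))) := by
    filter_upwards [(ae_ball_iff (Finset.Icc 1 m).countable_toSet).2 hX1] with ω hω
    have hp0 := hp.1
    have hp1 : 0 < 1 - p := by linarith [hp.2]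
    have key := average_exp_signs_le hp hm (x := fun j => (X j ω : ℝ)) (fun j hj => by
      rcases hω j hj with h | h <;> simp [h]) θ
    have hfact : ∑ j ∈ Finset.Icc 1 m, (g j 1 ω * ENNReal.ofReal (1 / m * p) +
        g j (-1) ω * ENNReal.ofReal (1 / m * (1 - p))) =
        Z ω * ENNReal.ofReal (∑ j ∈ Finset.Icc 1 m, (1 / (m : ℝ) * p * Real.exp (θ * X j ω) +
          1 / (m : ℝ) * (1 - p) * Real.exp (θ * -X j ω))) := by
      rw [ENNReal.ofReal_sum_of_nonneg (fun _ _ => by positivity), Finset.mul_sum]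
      refine Finset.sum_congr rfl fun j _ => ?_
      rw [ENNReal.ofReal_add (by positivity) (by positivity), mul_add,
        ENNReal.ofReal_mul (p := 1 / (m : ℝ) * p) (by positivity),
        ENNReal.ofReal_mul (p := 1 / (m : ℝ) * (1 - p)) (by positivity)]
      simp only [hgdef, one_mul, neg_one_mul, Int.cast_neg]
      ring
    rw [hfact, mul_left_comm, ← ENNReal.ofReal_mul (Real.exp_pos _).le]
    push_cast
    gcongr
  calc ∫⁻ ω, Z ω * ENNReal.ofReal (Real.exp (θ * ((ε ω * X (U ω) ω : ℤ) : ℝ))) ∂P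
      = ∑ j ∈ Finset.Icc 1 m, ∫⁻ ω, (g j 1 ω * (A j 1).indicator 1 ω +
        g j (-1) ω * (A j (-1)).indicator 1 ω) ∂P := by
        rw [lintegral_congr_ae hsplit, lintegral_finsetSum]
        intro j hj
        exact (hgi j hj 1).add (hgi j hj (-1))
    _ = ∑ j ∈ Finset.Icc 1 m, ∫⁻ ω, (g j 1 ω * ENNReal.ofReal (1 / m * p) +
        g j (-1) ω * ENNReal.ofReal (1 / m * (1 - p))) ∂P := by
        refine Finset.sum_congr rfl fun j hj => ?_
        rw [lintegral_add_left (hgi j hj 1),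
          hind j hj, hind j hj, lintegral_add_left ((hgm j hj 1).mul_const _),
          lintegral_mul_const _ (hgm j hj 1), lintegral_mul_const _ (hgm j hj (-1)),
          ← hpos j hj, ← hneg j hj]
    _ = ∫⁻ ω, ∑ j ∈ Finset.Icc 1 m, (g j 1 ω * ENNReal.ofReal (1 / m * p) +
        g j (-1) ω * ENNReal.ofReal (1 / m * (1 - p))) ∂P := by
        rw [lintegral_finsetSum]
        intro j hj
        exact ((hgm j hj 1).mul_const _).add ((hgm j hj (-1)).mul_const _)
    _ ≤ _ := by
        rw [← lintegral_const_mul' _ _ ENNReal.ofReal_ne_top]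
        exact lintegral_mono_ae hpw

end Recall

/-! ### Measurability, independence and exponential moments for the walk and its rows -/

theorem measurable_of_measurable_natCast_int {Ω : Type*} {F : MeasurableSpace Ω} {U : Ω → ℕ}
    (hU : Measurable fun ω => (U ω : ℤ)) : Measurable U :=
  (measurable_from_top (f := Int.toNat)).comp hU

namespace ERWNoise

section Measurability

variable {Ω : Type*} {F : MeasurableSpace Ω} {N : ERWNoise Ω} {m : ℕ → ℕ}

/-- The σ-algebra is arbitrary, so that the lemma also applies to the one generated by the sources
other than the pair about to be integrated out. -/
theorem measurable_step_of_lt {n : ℕ} (hfirst : Measurable N.first)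
    (hmem : ∀ j, 1 ≤ j → j < n → Measurable (N.memory j))
    (hsign : ∀ j, 1 ≤ j → j < n → Measurable (N.sign j)) (k : ℕ) (hk : k ≤ n) :
    Measurable fun ω => N.step ω k := by
  induction k using Nat.strong_induction_on with
  | _ k ih =>
    match k, ih, hk with
    | 0, _, _ => simp only [step]; exact measurable_const
    | 1, _, _ => simpa only [step] using hfirst
    | k + 2, ih, hk =>
      -- If the recalled time is at least `k + 2`, all indicators vanish, matching the default value
      -- 0 of `step`.
      have heq : (fun ω => N.step ω (k + 2)) = fun ω => ∑ i ∈ Finset.range (k + 2),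
          {ω | N.memory (k + 1) ω = i}.indicator
            (fun ω => N.sign (k + 1) ω * N.step ω i) ω := by
        funext ω
        rw [step]
        simp [Set.indicator_apply]
      rw [heq]
      refine Finset.measurable_sum _ fun i hi => Measurable.indicator ?_ ?_
      · exact (hsign _ (by omega) (by omega)).mul
          (ih i (Finset.mem_range.1 hi) (by have := Finset.mem_range.1 hi; omega))
      · exact hmem _ (by omega) (by omega) (measurableSet_singleton i)

theorem measurable_rowStep {n k : ℕ} (hstep : ∀ i, Measurable fun ω => N.step ω i)
    (hmem : m n < k → Measurable (N.rowMemory n k))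
    (hsign : m n < k → Measurable (N.rowSign n k)) :
    Measurable (N.rowStep m n k) := by
  unfold rowStep
  split_ifs with h
  · exact hstep k
  · have hpair : Measurable fun q : ℕ × Ω => N.step q.2 q.1 :=
      measurable_from_prod_countable_right hstep
    exact (hsign (by omega)).mul (hpair.comp ((hmem (by omega)).prodMk measurable_id))

end Measurability

section Definitions

variable {Ω : Type*} {N : ERWNoise Ω} {m : ℕ → ℕ}

/-- The `σ`-algebra generated by all sources whose label is in `L`. -/
abbrev sourceSigma (N : ERWNoise Ω) (m : ℕ → ℕ) (L : Set (ERWLabel m)) : MeasurableSpace Ω :=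
  ⨆ i ∈ L, MeasurableSpace.comap (N.source m i) inferInstance

theorem measurable_source_sourceSigma {L : Set (ERWLabel m)} {i : ERWLabel m} (hi : i ∈ L) :
    Measurable[N.sourceSigma m L] (N.source m i) :=
  (comap_measurable (N.source m i)).mono
    (le_iSup₂ (f := fun i (_ : i ∈ L) => MeasurableSpace.comap (N.source m i) inferInstance) i hi)
    le_rfl

/-- The partial sums of the ordinary elephant random walk. -/
def walkSum (N : ERWNoise Ω) (n : ℕ) (ω : Ω) : ℤ :=
  ∑ i ∈ Finset.Icc 1 n, N.step ω i

/-- The sum of the steps `m n < i ≤ k` of the row `n`, centred given the ordinary walk. -/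
noncomputable def rowDeviation (N : ERWNoise Ω) (m : ℕ → ℕ) (p : ℝ) (n k : ℕ) (ω : Ω) : ℝ :=
  ∑ i ∈ Finset.Ioc (m n) k,
    ((N.rowStep m n i ω : ℝ) - (2 * p - 1) * (N.walkSum (m n) ω : ℝ) / m n)

theorem increasingMemoryWalk_eq (N : ERWNoise Ω) (m : ℕ → ℕ) (p : ℝ) {n : ℕ} (hm1 : 1 ≤ m n)
    (hmn : m n ≤ n) (ω : Ω) :
    (m n : ℝ) * N.increasingMemoryWalk m n ω =
      (m n + (n - m n) * (2 * p - 1)) * N.walkSum (m n) ω + m n * N.rowDeviation m p n n ω := by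
  have hm0 : (0 : ℝ) < m n := by exact_mod_cast hm1
  have hsplit : N.increasingMemoryWalk m n ω =
      N.walkSum (m n) ω + ∑ i ∈ Finset.Ioc (m n) n, N.rowStep m n i ω := by
    have hI : ∀ k, Finset.Icc 1 k = Finset.Ioc 0 k := fun k => rfl
    rw [increasingMemoryWalk, rowSum, walkSum, hI, hI,
      ← Finset.sum_Ioc_consecutive _ (Nat.zero_le _) hmn]
    congr 1
    refine Finset.sum_congr rfl fun i hi => ?_
    rw [rowStep, if_pos (Finset.mem_Ioc.1 hi).2]
  rw [hsplit, rowDeviation, Finset.sum_sub_distrib, Finset.sum_const, Nat.card_Ioc, nsmul_eq_mul,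
    Nat.cast_sub hmn]
  push_cast
  field_simp
  ring

end Definitions

section Law

variable {Ω : Type*} [mΩ : MeasurableSpace Ω] {P : Measure Ω} {N : ERWNoise Ω} {s p : ℝ}
  {m : ℕ → ℕ}

namespace HasERWLaw

theorem sourceSigma_le (hN : N.HasERWLaw P s p m) (L : Set (ERWLabel m)) :
    N.sourceSigma m L ≤ mΩ :=
  iSup₂_le fun i _ => (hN.measurable_source i).comap_le

theorem indep_sourceSigma (hN : N.HasERWLaw P s p m) (L : Set (ERWLabel m)) :
    Indep (N.sourceSigma m Lᶜ) (N.sourceSigma m L) P :=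
  indep_iSup_of_disjoint (fun i => (hN.measurable_source i).comap_le)
    ((iIndepFun_iff_iIndep _ _ _).1 hN.indep) disjoint_compl_left

/-- Common to the walk and its rows: `a` labels the recalled time, `b` the sign, and all other
sources form the past. -/
theorem lintegral_exp_recall_le [IsProbabilityMeasure P] (hN : N.HasERWLaw P s p m)
    (hp : p ∈ Set.Ioo (0 : ℝ) 1) {a b : ERWLabel m} (hab : a ≠ b) {U : Ω → ℕ} {ε : Ω → ℤ}
    (ha : N.source m a = fun ω => (U ω : ℤ)) (hb : N.source m b = ε) {M : ℕ} (hM : 1 ≤ M)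
    (hunif : ∀ j ∈ Finset.Icc 1 M, P.real {ω | U ω = j} = 1 / (M : ℝ))
    (hpos : P.real {ω | ε ω = 1} = p) (hneg : P.real {ω | ε ω = -1} = 1 - p)
    {Z : Ω → ENNReal} (hZ : Measurable[N.sourceSigma m {a, b}ᶜ] Z) {X : ℕ → Ω → ℤ}
    (hX : ∀ j ∈ Finset.Icc 1 M, Measurable[N.sourceSigma m {a, b}ᶜ] (X j))
    (hX1 : ∀ j ∈ Finset.Icc 1 M, ∀ᵐ ω ∂P, X j ω = 1 ∨ X j ω = -1) (θ : ℝ) :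
    ∫⁻ ω, Z ω * ENNReal.ofReal (Real.exp (θ * ((ε ω * X (U ω) ω : ℤ) : ℝ))) ∂P ≤
      ENNReal.ofReal (Real.exp (θ ^ 2 / 2)) * ∫⁻ ω, Z ω * ENNReal.ofReal
        (Real.exp (θ * ((2 * p - 1) * ((∑ j ∈ Finset.Icc 1 M, X j ω : ℤ) : ℝ) / M))) ∂P := by
  have hUm : Measurable[N.sourceSigma m {a, b}] U := by
    refine measurable_of_measurable_natCast_int ?_
    rw [← ha]
    exact measurable_source_sourceSigma (by simp)
  have hεm : Measurable[N.sourceSigma m {a, b}] ε := by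
    rw [← hb]
    exact measurable_source_sourceSigma (by simp)
  have hle := hN.sourceSigma_le {a, b}
  have hjoint : ∀ (j : ℕ) (e : ℤ),
      P {ω | U ω = j ∧ ε ω = e} = P {ω | U ω = j} * P {ω | ε ω = e} := by
    intro j e
    have := (hN.indep.indepFun hab).measure_inter_preimage_eq_mul {(j : ℤ)} {e}
      (measurableSet_singleton _) (measurableSet_singleton _)
    rw [ha, hb] at this
    have h1 : (fun ω => (U ω : ℤ)) ⁻¹' {(j : ℤ)} = {ω | U ω = j} := by ext; simp
    rw [h1] at this
    exact this
  have hreal : ∀ {A : Set Ω} {r : ℝ}, P.real A = r → P A = ENNReal.ofReal r := by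
    intro A r h
    rw [← h, measureReal_def, ENNReal.ofReal_toReal (measure_ne_top P A)]
  have hM0 : (M : ℝ) ≠ 0 := by positivity
  refine lintegral_mul_exp_recall_le (hN.sourceSigma_le _) hle (hN.indep_sourceSigma {a, b}) hM hp
    hZ hX hX1 (fun j _ e => ?_) ?_ ?_ (fun j hj => ?_) (fun j hj => ?_) θ
  · exact (hUm (measurableSet_singleton j)).inter (hεm (measurableSet_singleton e))
  · refine ae_mem_of_sum_measureReal_eq_one
      (fun j _ => hle _ (hUm (measurableSet_singleton j))) ?_
    rw [Finset.sum_congr rfl hunif]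
    simp [hM0]
  · have := ae_mem_of_sum_measureReal_eq_one (P := P) (U := ε) (F := {1, -1})
      (fun j _ => hle _ (hεm (measurableSet_singleton j)))
      (by rw [Finset.sum_pair (by norm_num), hpos, hneg]; ring)
    simpa using this
  · rw [hjoint, hreal (hunif j hj), hreal hpos, ← ENNReal.ofReal_mul (by positivity)]
  · rw [hjoint, hreal (hunif j hj), hreal hneg, ← ENNReal.ofReal_mul (by positivity)]

theorem measurable_memory (hN : N.HasERWLaw P s p m) {n : ℕ} (hn : 1 ≤ n) :
    Measurable (N.memory n) :=
  measurable_of_measurable_natCast_int (hN.measurable_source (.memory n hn))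

theorem measurable_step (hN : N.HasERWLaw P s p m) (k : ℕ) : Measurable fun ω => N.step ω k :=
  measurable_step_of_lt (n := k) (hN.measurable_source .first)
    (fun _ hj _ => hN.measurable_memory hj)
    (fun j hj _ => hN.measurable_source (.sign j hj)) k le_rfl

theorem ae_memory_mem [IsProbabilityMeasure P] (hN : N.HasERWLaw P s p m) {n : ℕ} (hn : 1 ≤ n) :
    ∀ᵐ ω ∂P, N.memory n ω ∈ Finset.Icc 1 n := by
  have hn0 : (n : ℝ) ≠ 0 := by positivity
  refine ae_mem_of_sum_measureReal_eq_one
    (fun j _ => hN.measurable_memory hn (measurableSet_singleton j)) ?_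
  rw [Finset.sum_congr rfl (hN.memory_unif n hn)]
  simp [hn0]

theorem ae_step_eq_one_or_neg_one [IsProbabilityMeasure P] (hN : N.HasERWLaw P s p m) {n : ℕ}
    (hn : 1 ≤ n) : ∀ᵐ ω ∂P, N.step ω n = 1 ∨ N.step ω n = -1 := by
  have hfirst : ∀ᵐ ω ∂P, N.first ω ∈ ({1, -1} : Finset ℤ) :=
    ae_mem_of_sum_measureReal_eq_one
      (fun j _ => hN.measurable_source .first (measurableSet_singleton j))
      (by rw [Finset.sum_pair (by norm_num), hN.first_pos, hN.first_neg]; ring)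
  have hsign : ∀ᵐ ω ∂P, ∀ k, 1 ≤ k → N.sign k ω ∈ ({1, -1} : Finset ℤ) :=
    ae_all_iff.2 fun k => by
      by_cases hk : 1 ≤ k
      · filter_upwards [ae_mem_of_sum_measureReal_eq_one (P := P) (U := N.sign k) (F := {1, -1})
          (fun j _ => hN.measurable_source (.sign k hk) (measurableSet_singleton j))
          (by rw [Finset.sum_pair (by norm_num), hN.sign_pos k hk, hN.sign_neg k hk]; ring)]
          with ω h _ using h
      · exact ae_of_all _ fun ω h => absurd h hk
  have hmem : ∀ᵐ ω ∂P, ∀ k, 1 ≤ k → N.memory k ω ∈ Finset.Icc 1 k :=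
    ae_all_iff.2 fun k => by
      by_cases hk : 1 ≤ k
      · filter_upwards [hN.ae_memory_mem hk] with ω h _ using h
      · exact ae_of_all _ fun ω h => absurd h hk
  filter_upwards [hfirst, hsign, hmem] with ω h1 h2 h3
  induction n using Nat.strong_induction_on with
  | _ n ih =>
    match n, hn, ih with
    | 1, _, _ => simpa [step] using h1
    | n + 2, _, ih =>
      obtain ⟨hl, hr⟩ := Finset.mem_Icc.1 (h3 (n + 1) (by omega))
      have hlt : N.memory (n + 1) ω < n + 2 := by omega
      have hs := h2 (n + 1) (by omega)
      simp only [Finset.mem_insert, Finset.mem_singleton] at hs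
      rw [step, dif_pos hlt]
      rcases hs with h | h <;> rcases ih _ hlt hl with h' | h' <;> simp [h, h']

theorem measurable_walkSum (hN : N.HasERWLaw P s p m) (n : ℕ) : Measurable (N.walkSum n) :=
  Finset.measurable_sum _ fun i _ => hN.measurable_step i

theorem lintegral_exp_walkSum_le [IsProbabilityMeasure P] (hN : N.HasERWLaw P s p m)
    (hp : p ∈ Set.Ioo (0 : ℝ) 1) {n : ℕ} (hn : 1 ≤ n) (θ : ℝ) :
    ∫⁻ ω, ENNReal.ofReal (Real.exp (θ * (N.walkSum n ω : ℝ))) ∂P ≤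
      ENNReal.ofReal (2 * Real.exp (θ ^ 2 * varianceProxy (2 * p - 1) n / 2)) := by
  -- The induction hypothesis is needed at `θ * (1 + (2p - 1) / n)`.
  induction n, hn using Nat.le_induction generalizing θ with
  | base =>
    have hbound : ∀ᵐ ω ∂P, ENNReal.ofReal (Real.exp (θ * (N.walkSum 1 ω : ℝ))) ≤
        ENNReal.ofReal (2 * Real.exp (θ ^ 2 * varianceProxy (2 * p - 1) 1 / 2)) := by
      filter_upwards [hN.ae_step_eq_one_or_neg_one le_rfl] with ω hω
      refine ENNReal.ofReal_le_ofReal ?_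
      -- The first step need not be centred, so `exp (± θ)` is bounded by `2 cosh θ`; this is the
      -- source of the factor 2.
      have hc := Real.cosh_le_exp_half_sq θ
      rw [Real.cosh_eq] at hc
      have h1 : varianceProxy (2 * p - 1) 1 = 1 := by simp [varianceProxy]
      have h2 : (N.walkSum 1 ω : ℝ) = N.step ω 1 := by simp [walkSum]
      rw [h1, h2, mul_one]
      have e1 := Real.exp_pos θ
      have e2 := Real.exp_pos (-θ)
      rcases hω with h | h <;> rw [h] <;> push_cast
      · rw [mul_one]; linarith
      · rw [mul_neg_one]; linarith
    refine (lintegral_mono_ae hbound).trans ?_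
    simp
  | succ n hn ih =>
    have hstep : ∀ i ≤ n, Measurable[N.sourceSigma m {.memory n hn, .sign n hn}ᶜ]
      fun ω => N.step ω i := by
      refine measurable_step_of_lt ?_ (fun j hj hjn => ?_) (fun j hj hjn => ?_)
      · exact measurable_source_sourceSigma (i := .first) (by simp)
      · exact measurable_of_measurable_natCast_int
          (measurable_source_sourceSigma (i := .memory j hj) (by simp; omega))
      · exact measurable_source_sourceSigma (i := .sign j hj) (by simp; omega)
    have hsum : Measurable[N.sourceSigma m {.memory n hn, .sign n hn}ᶜ]
      (N.walkSum n) :=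
      Finset.measurable_sum _ fun i hi => hstep i (Finset.mem_Icc.1 hi).2
    have hn0 : (0 : ℝ) < n := by exact_mod_cast hn
    have key := hN.lintegral_exp_recall_le hp (a := .memory n hn) (b := .sign n hn) (by simp)
      (U := N.memory n) (ε := N.sign n) rfl rfl hn (hN.memory_unif n hn) (hN.sign_pos n hn)
      (hN.sign_neg n hn)
      (Z := fun ω => ENNReal.ofReal (Real.exp (θ * (N.walkSum n ω : ℝ))))
      ((measurable_from_top (f := fun x : ℤ => ENNReal.ofReal (Real.exp (θ * (x : ℝ))))).comp hsum)
      (X := fun j ω => N.step ω j) (fun j hj => hstep j (Finset.mem_Icc.1 hj).2)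
      (fun j hj => hN.ae_step_eq_one_or_neg_one (Finset.mem_Icc.1 hj).1) θ
    have hleft : ∫⁻ ω, ENNReal.ofReal (Real.exp (θ * (N.walkSum (n + 1) ω : ℝ))) ∂P =
        ∫⁻ ω, ENNReal.ofReal (Real.exp (θ * (N.walkSum n ω : ℝ))) * ENNReal.ofReal
          (Real.exp (θ * ((N.sign n ω * N.step ω (N.memory n ω) : ℤ) : ℝ))) ∂P := by
      refine lintegral_congr_ae ?_
      filter_upwards [hN.ae_memory_mem hn] with ω hω
      obtain ⟨l, rfl⟩ := Nat.exists_eq_add_of_le' hn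
      have hlt : N.memory (l + 1) ω < l + 2 := by have := (Finset.mem_Icc.1 hω).2; omega
      have hst : N.walkSum (l + 1 + 1) ω = N.walkSum (l + 1) ω +
          N.sign (l + 1) ω * N.step ω (N.memory (l + 1) ω) := by
        rw [walkSum, Finset.sum_Icc_succ_top (by omega), step, dif_pos hlt, walkSum]
      rw [hst, ← ENNReal.ofReal_mul (Real.exp_pos _).le, ← Real.exp_add, Int.cast_add, mul_add]
    have hright : ∀ ω, ENNReal.ofReal (Real.exp (θ * (N.walkSum n ω : ℝ))) * ENNReal.ofReal
        (Real.exp (θ * ((2 * p - 1) * ((∑ j ∈ Finset.Icc 1 n, N.step ω j : ℤ) : ℝ) / n))) =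
        ENNReal.ofReal (Real.exp (θ * (1 + (2 * p - 1) / n) * (N.walkSum n ω : ℝ))) := by
      intro ω
      rw [← ENNReal.ofReal_mul (Real.exp_pos _).le, ← Real.exp_add]
      congr 2
      simp only [walkSum]
      ring
    rw [hleft]
    refine key.trans ?_
    rw [lintegral_congr hright]
    refine (mul_le_mul_right (ih _) _).trans ?_
    rw [← ENNReal.ofReal_mul (Real.exp_pos _).le, mul_left_comm, ← Real.exp_add, varianceProxy]
    exact ENNReal.ofReal_le_ofReal (le_of_eq (by congr 2; ring))

theorem measurable_rowDeviation (hN : N.HasERWLaw P s p m) (n : ℕ) :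
    Measurable (N.rowDeviation m p n n) := by
  refine Finset.measurable_sum _ fun i hi => ?_
  obtain ⟨h1, h2⟩ := Finset.mem_Ioc.1 hi
  have hrow : Measurable (N.rowStep m n i) := measurable_rowStep hN.measurable_step
    (fun h => measurable_of_measurable_natCast_int (hN.measurable_source (.rowMemory n i h h2)))
    (fun h => hN.measurable_source (.rowSign n i h h2))
  have hw := hN.measurable_walkSum (m n)
  have hcast : Measurable fun x : ℤ => (x : ℝ) := measurable_from_top
  exact (hcast.comp hrow).sub (((hcast.comp hw).const_mul _).div_const _)

/-- Every new step recalls the same first `m n` steps, so its conditional mean is cancelled exactly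
by the centring and each step costs only `exp (θ² / 2)`, at unchanged `θ`. -/
theorem lintegral_exp_rowDeviation_le [IsProbabilityMeasure P] (hN : N.HasERWLaw P s p m)
    (hp : p ∈ Set.Ioo (0 : ℝ) 1) {n k : ℕ} (hm : 1 ≤ m n) (hk : m n ≤ k) (hkn : k ≤ n) (θ : ℝ) :
    ∫⁻ ω, ENNReal.ofReal (Real.exp (θ * N.rowDeviation m p n k ω)) ∂P ≤
      ENNReal.ofReal (Real.exp (θ ^ 2 * ((k : ℝ) - m n) / 2)) := by
  induction k, hk using Nat.le_induction with
  | base => simp [rowDeviation]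
  | succ k hk ih =>
    have hmk : m n < k + 1 := by omega
    have hstep : ∀ i, Measurable[N.sourceSigma m
      {.rowMemory n (k + 1) hmk hkn, .rowSign n (k + 1) hmk hkn}ᶜ] fun ω => N.step ω i := by
      refine fun i => measurable_step_of_lt ?_ (fun j hj hjn => ?_) (fun j hj hjn => ?_) i le_rfl
      · exact measurable_source_sourceSigma (i := .first) (by simp)
      · exact measurable_of_measurable_natCast_int
          (measurable_source_sourceSigma (i := .memory j hj) (by simp))
      · exact measurable_source_sourceSigma (i := .sign j hj) (by simp)
    have hrow : ∀ i ∈ Finset.Ioc (m n) k, Measurable[N.sourceSigma m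
      {.rowMemory n (k + 1) hmk hkn, .rowSign n (k + 1) hmk hkn}ᶜ] (N.rowStep m n i) := by
      intro i hi
      obtain ⟨h1, h2⟩ := Finset.mem_Ioc.1 hi
      refine measurable_rowStep hstep (fun h => ?_) (fun h => ?_)
      · exact measurable_of_measurable_natCast_int
          (measurable_source_sourceSigma (i := .rowMemory n i h (by omega)) (by simp; omega))
      · exact measurable_source_sourceSigma (i := .rowSign n i h (by omega)) (by simp; omega)
    have hcast : Measurable fun x : ℤ => (x : ℝ) := measurable_from_top
    have hmean : Measurable[N.sourceSigma m
      {.rowMemory n (k + 1) hmk hkn, .rowSign n (k + 1) hmk hkn}ᶜ]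
      fun ω => (2 * p - 1) * (N.walkSum (m n) ω : ℝ) / m n :=
      ((hcast.comp (Finset.measurable_sum (Finset.Icc 1 (m n)) fun i _ =>
        hstep i)).const_mul _).div_const _
    have hdev : Measurable[N.sourceSigma m
      {.rowMemory n (k + 1) hmk hkn, .rowSign n (k + 1) hmk hkn}ᶜ] (N.rowDeviation m p n k) :=
      Finset.measurable_sum _ fun i hi => (hcast.comp (hrow i hi)).sub hmean
    have key := hN.lintegral_exp_recall_le hp (a := .rowMemory n (k + 1) hmk hkn)
      (b := .rowSign n (k + 1) hmk hkn) (by simp) (U := N.rowMemory n (k + 1))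
      (ε := N.rowSign n (k + 1)) rfl rfl hm (hN.rowMemory_unif n (k + 1) hmk hkn)
      (hN.rowSign_pos n (k + 1) hmk hkn) (hN.rowSign_neg n (k + 1) hmk hkn)
      -- The centring of step `k + 1` depends only on the ordinary walk, hence is put into `Z`.
      (Z := fun ω => ENNReal.ofReal (Real.exp (θ * (N.rowDeviation m p n k ω -
        (2 * p - 1) * (N.walkSum (m n) ω : ℝ) / m n))))
      (ENNReal.measurable_ofReal.comp (Real.measurable_exp.comp ((hdev.sub hmean).const_mul θ)))
      (X := fun j ω => N.step ω j) (fun j _ => hstep j)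
      (fun j hj => hN.ae_step_eq_one_or_neg_one (Finset.mem_Icc.1 hj).1) θ
    have hleft : ∀ ω, ENNReal.ofReal (Real.exp (θ * N.rowDeviation m p n (k + 1) ω)) =
        ENNReal.ofReal (Real.exp (θ * (N.rowDeviation m p n k ω -
          (2 * p - 1) * (N.walkSum (m n) ω : ℝ) / m n))) * ENNReal.ofReal
          (Real.exp (θ * ((N.rowSign n (k + 1) ω *
            N.step ω (N.rowMemory n (k + 1) ω) : ℤ) : ℝ))) := by
      intro ω
      rw [← ENNReal.ofReal_mul (Real.exp_pos _).le, ← Real.exp_add]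
      congr 2
      have : N.rowStep m n (k + 1) ω =
          N.rowSign n (k + 1) ω * N.step ω (N.rowMemory n (k + 1) ω) := by
        rw [rowStep, if_neg (by omega)]
      rw [rowDeviation, Finset.sum_Ioc_succ_top hk, ← rowDeviation, this]
      ring
    have hright : ∀ ω, ENNReal.ofReal (Real.exp (θ * (N.rowDeviation m p n k ω -
          (2 * p - 1) * (N.walkSum (m n) ω : ℝ) / m n))) * ENNReal.ofReal
        (Real.exp (θ * ((2 * p - 1) *
          ((∑ j ∈ Finset.Icc 1 (m n), N.step ω j : ℤ) : ℝ) / m n))) =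
        ENNReal.ofReal (Real.exp (θ * N.rowDeviation m p n k ω)) := by
      intro ω
      rw [← ENNReal.ofReal_mul (Real.exp_pos _).le, ← Real.exp_add]
      congr 2
      simp only [walkSum]
      ring
    rw [lintegral_congr hleft]
    refine key.trans ?_
    rw [lintegral_congr hright]
    refine (mul_le_mul_right (ih (by omega)) _).trans ?_
    rw [← ENNReal.ofReal_mul (Real.exp_pos _).le, ← Real.exp_add]
    exact ENNReal.ofReal_le_ofReal (le_of_eq (by congr 1; push_cast; ring))

/-- The strong law of large numbers with rate for the elephant random walk. -/
theorem ae_tendsto_walkSum_div_rpow [IsProbabilityMeasure P] (hN : N.HasERWLaw P s p m)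
    (hp : p ∈ Set.Ioo (0 : ℝ) 1) {c : ℝ} (hc : max (2 * p - 1) (1 / 2) < c) :
    ∀ᵐ ω ∂P, Tendsto (fun n : ℕ => (N.walkSum n ω : ℝ) / (n : ℝ) ^ c) atTop (𝓝 0) := by
  obtain ⟨b, hb, hbc⟩ := exists_between hc
  obtain ⟨C, hC, hv⟩ := exists_varianceProxy_le ((le_max_left _ _).trans_lt hb)
    ((le_max_right _ _).trans_lt hb)
  refine ae_tendsto_div_rpow_of_lintegral_exp_le
    (fun n => (measurable_from_top (f := fun x : ℤ => (x : ℝ))).comp (hN.measurable_walkSum n))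
    hbc hC fun n hn θ => (hN.lintegral_exp_walkSum_le hp hn θ).trans (ENNReal.ofReal_le_ofReal ?_)
  have := hv n hn
  gcongr

theorem ae_tendsto_rowDeviation_div_rpow [IsProbabilityMeasure P] (hN : N.HasERWLaw P s p m)
    (hp : p ∈ Set.Ioo (0 : ℝ) 1) (hm : ∀ n : ℕ, 1 ≤ n → 1 ≤ m n ∧ m n ≤ n) {c : ℝ}
    (hc : 1 / 2 < c) :
    ∀ᵐ ω ∂P, Tendsto (fun n : ℕ => N.rowDeviation m p n n ω / (n : ℝ) ^ c) atTop (𝓝 0) := by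
  refine ae_tendsto_div_rpow_of_lintegral_exp_le hN.measurable_rowDeviation hc one_pos
    fun n hn θ => (hN.lintegral_exp_rowDeviation_le hp (hm n hn).1 (hm n hn).2 le_rfl θ).trans
      (ENNReal.ofReal_le_ofReal ?_)
  -- The general criterion is used with `b = 1 / 2` and `C = 1`.
  have h1 : Real.exp (θ ^ 2 * ((n : ℝ) - m n) / 2) ≤
      Real.exp (θ ^ 2 * (1 * (n : ℝ) ^ (2 * (1 / 2 : ℝ))) / 2) := by
    rw [mul_one_div_cancel two_ne_zero, Real.rpow_one, one_mul]
    gcongr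
    exact sub_le_self _ (Nat.cast_nonneg _)
  linarith [Real.exp_pos (θ ^ 2 * (1 * (n : ℝ) ^ (2 * (1 / 2 : ℝ))) / 2)]

end HasERWLaw

end Law

end ERWNoise

/-! ### The strong law for the walk with gradually increasing memory -/

/-- The distances to `n` and `-n` are `2 (n - k) (1 - p)` and `2k + 2 (n - k) p`. -/
theorem abs_memory_coefficient_le {p : ℝ} (hp : p ∈ Set.Ioo (0 : ℝ) 1) {k n : ℝ} (hk : 0 ≤ k)
    (hkn : k ≤ n) : |k + (n - k) * (2 * p - 1)| ≤ n := by
  have h1 := mul_nonneg (sub_nonneg.2 hkn) hp.1.le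
  have h2 := mul_nonneg (sub_nonneg.2 hkn) (sub_nonneg.2 hp.2.le)
  rw [abs_le]
  constructor <;> nlinarith

theorem ERWNoise.abs_increasingMemoryWalk_le {Ω : Type*} (N : ERWNoise Ω) (m : ℕ → ℕ) {p : ℝ}
    (hp : p ∈ Set.Ioo (0 : ℝ) 1) {n : ℕ} (hm1 : 1 ≤ m n) (hmn : m n ≤ n) (ω : Ω) :
    (m n : ℝ) / n * |(N.increasingMemoryWalk m n ω : ℝ)| ≤
      |(N.walkSum (m n) ω : ℝ)| + (m n : ℝ) / n * |N.rowDeviation m p n n ω| := by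
  have hm0 : (0 : ℝ) < m n := by exact_mod_cast hm1
  have hn0 : (0 : ℝ) < n := by exact_mod_cast hm1.trans hmn
  have hmn' : (m n : ℝ) ≤ n := by exact_mod_cast hmn
  have h := congrArg abs (N.increasingMemoryWalk_eq m p hm1 hmn ω)
  rw [abs_mul, abs_of_pos hm0] at h
  have h2 := abs_add_le (((m n : ℝ) + (n - m n) * (2 * p - 1)) * N.walkSum (m n) ω)
    (m n * N.rowDeviation m p n n ω)
  rw [abs_mul, abs_mul, abs_of_pos hm0] at h2
  have h3 := mul_le_mul_of_nonneg_right (abs_memory_coefficient_le hp hm0.le hmn')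
    (abs_nonneg (N.walkSum (m n) ω : ℝ))
  rw [div_mul_eq_mul_div, div_mul_eq_mul_div, div_le_iff₀ hn0, add_mul, div_mul_cancel₀ _ hn0.ne']
  linarith

theorem theorem2p2 {Ω : Type*} [MeasurableSpace Ω] (P : Measure Ω) [IsProbabilityMeasure P]
    (s p α γ : ℝ) (m : ℕ → ℕ) (N : ERWNoise Ω)
    (hs : s ∈ Set.Icc (0 : ℝ) 1) (hp : p ∈ Set.Ioo (0 : ℝ) 1) (hα : α = 2 * p - 1)
    (hm : ∀ n : ℕ, 1 ≤ n → 1 ≤ m n ∧ m n ≤ n)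
    (hm_top : Tendsto m atTop atTop)
    (hγ : γ ∈ Set.Icc (0 : ℝ) 1)
    (hm_lim : Tendsto (fun n : ℕ => (m n : ℝ) / (n : ℝ)) atTop (𝓝 γ))
    (hN : N.HasERWLaw P s p m) :
    (∀ᵐ ω ∂P, Tendsto (fun n : ℕ => (N.increasingMemoryWalk m n ω : ℝ) / (n : ℝ))
      atTop (𝓝 0)) ∧
    ∀ c : ℝ, c ∈ Set.Ioo (max α (1 / 2)) 1 →
      ∀ᵐ ω ∂P, Tendsto
        (fun n : ℕ => ((m n : ℝ) / (n : ℝ)) * (N.increasingMemoryWalk m n ω : ℝ) / (m n : ℝ) ^ c)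
        atTop (𝓝 0) := by
  subst hα
  -- The endpoint `c = 1` is included: it yields the first claim.
  have main : ∀ c : ℝ, max (2 * p - 1) (1 / 2) < c → c ≤ 1 → ∀ᵐ ω ∂P, Tendsto
        (fun n : ℕ => ((m n : ℝ) / (n : ℝ)) * (N.increasingMemoryWalk m n ω : ℝ) / (m n : ℝ) ^ c)
        atTop (𝓝 0) := by
    intro c hc hc1
    filter_upwards [hN.ae_tendsto_walkSum_div_rpow hp hc,
      hN.ae_tendsto_rowDeviation_div_rpow hp hm ((le_max_right _ _).trans_lt hc)] with ω hS hD
    have hbound := (hS.comp hm_top).abs.add hD.abs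
    rw [abs_zero, add_zero] at hbound
    refine squeeze_zero_norm' ?_ hbound
    filter_upwards [eventually_ge_atTop 1] with n hn
    obtain ⟨hm1, hmn⟩ := hm n hn
    have hm0 : (0 : ℝ) < m n := by exact_mod_cast hm1
    have hn0 : (0 : ℝ) < n := by exact_mod_cast hn
    have hmn' : (m n : ℝ) ≤ n := by exact_mod_cast hmn
    have hmc : 0 < (m n : ℝ) ^ c := Real.rpow_pos_of_pos hm0 c
    have hnc : 0 < (n : ℝ) ^ c := Real.rpow_pos_of_pos hn0 c
    -- Equivalent to `(m n)^(1 - c) ≤ n^(1 - c)`, where `c ≤ 1` enters.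
    have hratio : (m n : ℝ) / n / (m n : ℝ) ^ c ≤ 1 / (n : ℝ) ^ c := by
      have h := Real.rpow_le_rpow hm0.le hmn' (sub_nonneg.2 hc1)
      rw [Real.rpow_sub hm0, Real.rpow_sub hn0, Real.rpow_one, Real.rpow_one,
        div_le_div_iff₀ hmc hnc] at h
      rw [div_div, div_le_div_iff₀ (by positivity) hnc]
      linarith
    have h := div_le_div_of_nonneg_right (N.abs_increasingMemoryWalk_le m hp hm1 hmn ω) hmc.le
    simp only [Function.comp, Real.norm_eq_abs]
    rw [abs_div, abs_mul, abs_of_pos hmc, abs_of_pos (div_pos hm0 hn0), abs_div, abs_of_pos hmc,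
      abs_div, abs_of_pos hnc]
    refine h.trans ?_
    rw [add_div]
    refine add_le_add le_rfl ?_
    calc (m n : ℝ) / n * |N.rowDeviation m p n n ω| / (m n : ℝ) ^ c
        = (m n : ℝ) / n / (m n : ℝ) ^ c * |N.rowDeviation m p n n ω| := by ring
      _ ≤ 1 / (n : ℝ) ^ c * |N.rowDeviation m p n n ω| := by gcongr
      _ = _ := by ring
  refine ⟨?_, fun c hc => main c hc.1 hc.2.le⟩
  have hlt : max (2 * p - 1) (1 / 2) < 1 := max_lt (by linarith [hp.2]) (by norm_num)
  filter_upwards [main 1 hlt le_rfl] with ω hω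
  refine hω.congr' ?_
  filter_upwards [eventually_ge_atTop 1] with n hn
  have hm0 : (m n : ℝ) ≠ 0 := by exact_mod_cast (Nat.one_le_iff_ne_zero.1 (hm n hn).1)
  rw [Real.rpow_one]
  field_simp
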